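/- Let $n\ge 2$ be an integer. For $y\in\mathbb R^n$ and $k\in\{0,1,\dots,n-1\}$ put $$E_k(y)=\sum_{1\le i_1<\dots<i_{n-k}\le n} y_{i_1}y_{i_2}\cdots y_{i_{n-k}},$$ and let $\Delta_n=\{y\in(0,\infty)^n : y_1\le y_2\le\dots\le y_n\}$. For a nonempty set $S\subseteq\{1,\dots,n-1\}$, let $\mathrm{Conj}(n,S)$ denote the following assertion. For every $a\in\Delta_n$ for which there exist $A_k>0$ ($k\in S$) such that all (complex) roots of $(x+a_1)\cdots(x+a_n)+\sum_{k\in S}A_kx^k$ are real, there exist $\varepsilon>0$ and nondecreasing functions $B_k:[0,\varepsilon]\to\mathbb R$ ($k\in S$), continuous on $[0,\varepsilon]$ and differentiable on $(0,\varepsilon)$, with $B_k(0)=0$, such that $\sum_{k\in S}B_k(t)$ is strictly increasing on $[0,\varepsilon]$ and, for all sufficiently small $t>0$, the polynomial $(x+a_1)\cdots(x+a_n)+\sum_{k\in S}B_k(t)x^k$ has $n$ distinct real roots. Let $T\subseteq\{1,\dots,n-1\}$ be an arbitrary subset and suppose that $\mathrm{Conj}(n,S)$ holds for every nonempty $S\subseteq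 T$. Let $f\in C^n(0,\infty)$ be real-valued. Then the following two conditions are equivalent: 1. $f(a_1)+\dots+f(a_n)\le f(b_1)+\dots+f(b_n)$ for all $a,b\in\Delta_n$ such that $E_k(a)\le E_k(b)$ for all $k\in T$, and $E_k(a)=E_k(b)$ for all $k\in\{0,1,\dots,n-1\}$ with $k=0$ or $k\notin T$; 2. $(-1)^{n+k}\,\bigl(x^kf'(x)\bigr)^{(n-1)}\le 0$ for all $x>0$ and all $k\in T$. -/

import Mathlib

open Polynomial Topology Set

noncomputable section

/-- The elementary symmetric polynomials in reverse order, `E_k(y) = e_{n-k}(y)`,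
for `0 ≤ k ≤ n - 1`. -/
def revEsymm (n k : ℕ) (y : Fin n → ℝ) : ℝ :=
  (Finset.univ.val.map y).esymm (n - k)

/-- `Δ_n`: the nondecreasingly ordered `n`-tuples of positive real numbers. -/
def orderedTuples (n : ℕ) : Set (Fin n → ℝ) :=
  {y | (∀ i, 0 < y i) ∧ Monotone y}

/-- The polynomial `(x + a_1) ⋯ (x + a_n) + ∑_{k ∈ S} c_k x^k`. -/
def perturbedPoly {n : ℕ} (a : Fin n → ℝ) (S : Finset ℕ) (c : ℕ → ℝ) : ℝ[X] :=
  ∏ i, (X + C (a i)) + ∑ k ∈ S, C (c k) * X ^ k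

/-- The assertion of the conjecture on real-rooted polynomials for given `n` and `S`
(and all `a ∈ Δ_n`). -/
def MainConjecture (n : ℕ) (S : Finset ℕ) : Prop :=
  ∀ a ∈ orderedTuples n,
    (∃ A : ℕ → ℝ, (∀ k ∈ S, 0 < A k) ∧
      ∀ z : ℂ, aeval z (perturbedPoly a S A) = 0 → z.im = 0) →
    ∃ ε : ℝ, 0 < ε ∧ ∃ B : ℕ → ℝ → ℝ,
      (∀ k ∈ S, ContinuousOn (B k) (Icc 0 ε) ∧ DifferentiableOn ℝ (B k) (Ioo 0 ε) ∧
        MonotoneOn (B k) (Icc 0 ε) ∧ B k 0 = 0) ∧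
      StrictMonoOn (fun t => ∑ k ∈ S, B k t) (Icc 0 ε) ∧
      ∀ᶠ t in 𝓝[>] (0 : ℝ), ∃ x : Fin n → ℝ, Function.Injective x ∧
        ∀ i, (perturbedPoly a S (fun k => B k t)).IsRoot (x i)

end

/-! The numbers `E_k(y)` are the coefficients of the monic polynomial with roots `-y_i`. If the
coefficients `c_k` of this polynomial move while the `y_i` are distinct, implicit differentiation
gives `y_i' = ∑_k c_k' (-y_i)^k / ∏_{j≠i} (y_j - y_i)`. Hence the derivative of `∑ f(y_i)` is `∑_k
c_k'` times `-(-1)^(n+k)` times the divided difference of `x^k f'` at the `y_i`, and that divided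
difference is a value of `(x^k f')^(n-1)` divided by `(n-1)!` (`hasDerivWithinAt_sum_comp_root`,
`exists_iteratedDeriv_eq_weighted_sum`).

If the sign condition fails at `x₀`, it fails nearby; raising the single coefficient `c_k` from
distinct points near `x₀` then strictly decreases the sum, against condition 1. This direction does
not need the conjecture.

Conversely, among the tuples whose `E_k` lie between those of `a` and `b` and whose `f`-sum is at
least that of `a`, compactness gives one, `c`, maximizing `∑ E_k`. If `c ≠ b`, let `S` be the set of
`k` with `E_k(c) < E_k(b)`. The polynomial of `b` shows that the conjecture applies to `c` and `S`,
and its curve increases `∑ E_k` without lowering the `f`-sum, contradicting maximality. -/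

/-! ### Divided differences. -/

/-- Iterated Rolle theorem: a `C^m` function with `m + 1` zeros in an interval has a zero of its
`m`-th derivative there. -/
theorem exists_iteratedDeriv_eq_zero {U : Set ℝ} (hU : IsOpen U) (hUc : U.OrdConnected) :
    ∀ (m : ℕ) (g : ℝ → ℝ) (x : Fin (m + 1) → ℝ), StrictMono x → ContDiffOn ℝ m g U →
      (∀ i, x i ∈ U) → (∀ i, g (x i) = 0) → ∃ ξ ∈ U, iteratedDeriv m g ξ = 0 := by
  intro m
  induction m with
  | zero =>
    intro g x _ _ hxU hg
    exact ⟨x 0, hxU 0, by simpa using hg 0⟩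
  | succ m ih =>
    intro g x hx hg hxU hgx
    have hz : ∀ i : Fin (m + 1), ∃ z ∈ Ioo (x i.castSucc) (x i.succ), deriv g z = 0 := by
      intro i
      refine exists_deriv_eq_zero (hx i.castSucc_lt_succ) (hg.continuousOn.mono ?_) ?_
      · exact hUc.out (hxU _) (hxU _)
      · rw [hgx, hgx]
    choose z hzm hz using hz
    have hzs : StrictMono z := fun i j hij =>
      (hzm i).2.trans_le ((hx.monotone (Fin.succ_le_castSucc_iff.2 hij)).trans (hzm j).1.le)
    obtain ⟨ξ, hξ, h⟩ := ih (deriv g) z hzs (hg.deriv_of_isOpen hU (by norm_cast))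
      (fun i => hUc.out (hxU _) (hxU _) (Ioo_subset_Icc_self (hzm i))) hz
    exact ⟨ξ, hξ, by rwa [iteratedDeriv_succ']⟩

/-- Mean value theorem for divided differences. -/
theorem exists_iteratedDeriv_eq_dividedDifference {U : Set ℝ} (hU : IsOpen U)
    (hUc : U.OrdConnected) (m : ℕ) (g : ℝ → ℝ) (x : Fin (m + 1) → ℝ) (hx : StrictMono x)
    (hg : ContDiffOn ℝ m g U) (hxU : ∀ i, x i ∈ U) :
    ∃ ξ ∈ U, iteratedDeriv m g ξ =
      m.factorial * ∑ i, g (x i) / ∏ j ∈ Finset.univ.erase i, (x i - x j) := by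
  have hinj : Set.InjOn x (Finset.univ : Finset (Fin (m + 1))) := hx.injective.injOn
  set P := Lagrange.interpolate Finset.univ x (fun i => g (x i))
  have hPx : ∀ i, P.eval (x i) = g (x i) := fun i =>
    Lagrange.eval_interpolate_at_node _ hinj (Finset.mem_univ i)
  have hPd : P.degree < (Finset.univ : Finset (Fin (m + 1))).card :=
    Lagrange.degree_interpolate_lt _ hinj
  have hPc : ContDiff ℝ m fun t => P.eval t := by simpa using P.contDiff_aeval (𝕜 := ℝ) (m : ℕ∞)
  obtain ⟨ξ, hξ, h⟩ := exists_iteratedDeriv_eq_zero hU hUc m (g - fun t => P.eval t) x hx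
    (hg.sub hPc.contDiffOn) hxU (fun i => by simp [hPx])
  refine ⟨ξ, hξ, ?_⟩
  rw [iteratedDeriv_sub (hg.contDiffAt (hU.mem_nhds hξ)) hPc.contDiffAt, sub_eq_zero] at h
  have hder : ∀ (k : ℕ) (Q : ℝ[X]),
      iteratedDeriv k (fun t => Q.eval t) = fun t => (derivative^[k] Q).eval t := by
    intro k
    induction k with
    | zero => intro Q; simp
    | succ k ih =>
      intro Q
      rw [iteratedDeriv_succ', Function.iterate_succ_apply, ← ih]
      congr 1
      ext t
      exact Q.deriv
  rw [h, hder]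
  dsimp only
  -- `P` has degree at most `m`, so its `m`-th derivative is constant: `m!` times the coefficient of
  -- degree `m`, which is the divided difference.
  rw [Lagrange.eval_iterate_derivative_eq_sum hinj hPd (by simp)]
  simp [hPx]

/-! ### Ordered tuples and their polynomials. -/

/-- The monic polynomial with roots `-y i`. -/
noncomputable def shiftProd {n : ℕ} (y : Fin n → ℝ) : ℝ[X] := ∏ i, (X + C (y i))

theorem perturbedPoly_eq {n : ℕ} (a : Fin n → ℝ) (S : Finset ℕ) (c : ℕ → ℝ) :
    perturbedPoly a S c = shiftProd a + ∑ k ∈ S, C (c k) * X ^ k := rfl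

theorem coeff_shiftProd {n k : ℕ} (y : Fin n → ℝ) (hk : k ≤ n) :
    (shiftProd y).coeff k = revEsymm n k y := by
  have := Multiset.prod_X_add_C_coeff' (Finset.univ : Finset (Fin n)).val y (k := k) (by simpa)
  rwa [← Finset.prod.eq_1, Finset.card_val, Finset.card_univ, Fintype.card_fin] at this

theorem monic_shiftProd {n : ℕ} (y : Fin n → ℝ) : (shiftProd y).Monic :=
  monic_prod_of_monic _ _ fun _ _ => monic_X_add_C _

theorem natDegree_shiftProd {n : ℕ} (y : Fin n → ℝ) : (shiftProd y).natDegree = n := by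
  rw [shiftProd, natDegree_prod_of_monic _ _ fun i _ => monic_X_add_C _]
  simp

theorem eval_shiftProd {n : ℕ} (y : Fin n → ℝ) (x : ℝ) :
    (shiftProd y).eval x = ∏ i, (x + y i) := by
  simp [shiftProd, eval_prod]

theorem revEsymm_self {n : ℕ} (y : Fin n → ℝ) : revEsymm n n y = 1 := by
  simp [revEsymm, Multiset.esymm]

theorem shiftProd_eq_of_revEsymm_eq {n : ℕ} {y z : Fin n → ℝ}
    (h : ∀ k < n, revEsymm n k y = revEsymm n k z) : shiftProd y = shiftProd z := by
  ext k
  rcases le_or_gt k n with hk | hk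
  · rw [coeff_shiftProd y hk, coeff_shiftProd z hk]
    rcases hk.lt_or_eq with hk | rfl
    · exact h k hk
    · rw [revEsymm_self, revEsymm_self]
  · rw [coeff_eq_zero_of_natDegree_lt (by rwa [natDegree_shiftProd]),
      coeff_eq_zero_of_natDegree_lt (by rwa [natDegree_shiftProd])]

theorem roots_shiftProd {n : ℕ} (y : Fin n → ℝ) :
    (shiftProd y).roots = Finset.univ.val.map fun i => -y i := by
  have : shiftProd y = (Multiset.map (fun a => X - C a)
      ((Finset.univ : Finset (Fin n)).val.map fun i => -y i)).prod := by
    rw [Multiset.map_map, ← Finset.prod.eq_1]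
    simp [shiftProd]
  rw [this, roots_multiset_prod_X_sub_C]

theorem eq_of_shiftProd_eq {n : ℕ} {y z : Fin n → ℝ} (hy : Monotone y) (hz : Monotone z)
    (h : shiftProd y = shiftProd z) : y = z := by
  have h1 := congrArg (fun p => p.roots.map Neg.neg) h
  simp only [roots_shiftProd, Multiset.map_map, Function.comp_def, neg_neg] at h1
  have h2 : (List.ofFn y).Perm (List.ofFn z) := by
    rw [← Multiset.coe_eq_coe, List.ofFn_eq_map, List.ofFn_eq_map]
    simpa [Fin.univ_def] using h1
  exact List.ofFn_injective (h2.eq_of_sortedLE hy.sortedLE_ofFn hz.sortedLE_ofFn)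

theorem continuous_revEsymm (n k : ℕ) : Continuous (revEsymm n k) := by
  have : revEsymm n k = fun y => ∑ t ∈ Finset.univ.powersetCard (n - k), ∏ i ∈ t, y i := by
    ext y
    exact Finset.esymm_map_val _ _ _
  rw [this]
  fun_prop

theorem revEsymm_zero {n : ℕ} (y : Fin n → ℝ) : revEsymm n 0 y = ∏ i, y i := by
  rw [← coeff_shiftProd y (Nat.zero_le n), coeff_zero_eq_eval_zero, eval_shiftProd]
  simp

theorem revEsymm_pred {n : ℕ} (hn : 1 ≤ n) (y : Fin n → ℝ) : revEsymm n (n - 1) y = ∑ i, y i := by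
  rw [revEsymm, Finset.esymm_map_val, Nat.sub_sub_self hn, Finset.powersetCard_one]
  simp

/-! ### Compactness and continuity of roots. -/

/-- The nondecreasing tuples of nonnegative reals whose `E_k` lie between given bounds. -/
def esymmBox (n : ℕ) (l u : ℕ → ℝ) : Set (Fin n → ℝ) :=
  {y | (∀ i, 0 ≤ y i) ∧ Monotone y ∧ ∀ k < n, l k ≤ revEsymm n k y ∧ revEsymm n k y ≤ u k}

/-- `E_(n-1)` is the sum of the entries, so its upper bound bounds every nonnegative entry. Allowing
zero entries keeps the set closed. -/
theorem isCompact_esymmBox {n : ℕ} (hn : 1 ≤ n) (l u : ℕ → ℝ) : IsCompact (esymmBox n l u) := by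
  refine (isCompact_Icc (a := (0 : Fin n → ℝ)) (b := fun _ => u (n - 1))).of_isClosed_subset ?_ ?_
  · have h1 : IsClosed {y : Fin n → ℝ | ∀ i, 0 ≤ y i} := by
      simp only [ofPred_forall]
      exact isClosed_iInter fun i => isClosed_le continuous_const (continuous_apply i)
    have h2 : IsClosed {y : Fin n → ℝ | Monotone y} := isClosed_monotone
    have h3 : IsClosed {y : Fin n → ℝ | ∀ k < n, l k ≤ revEsymm n k y ∧ revEsymm n k y ≤ u k} := by
      simp only [ofPred_forall, ofPred_and]
      exact isClosed_iInter fun k => isClosed_iInter fun _ =>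
        (isClosed_le continuous_const (continuous_revEsymm n k)).inter
          (isClosed_le (continuous_revEsymm n k) continuous_const)
    exact h1.inter (h2.inter h3)
  · rintro y ⟨hy, -, hE⟩
    refine ⟨hy, fun i => ?_⟩
    have h := (hE (n - 1) (by omega)).2
    rw [revEsymm_pred hn] at h
    exact (Finset.single_le_sum (fun j _ => hy j) (Finset.mem_univ i)).trans h

theorem pos_of_revEsymm_zero_pos {n : ℕ} {y : Fin n → ℝ} (hy : ∀ i, 0 ≤ y i)
    (h : 0 < revEsymm n 0 y) (i : Fin n) : 0 < y i := by
  rw [revEsymm_zero] at h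
  exact (hy i).lt_of_ne' fun h0 => h.ne' (Finset.prod_eq_zero (Finset.mem_univ i) h0)

/-- Sorted nonnegative roots depend continuously on the coefficients. -/
theorem tendsto_of_tendsto_revEsymm {n : ℕ} (hn : 1 ≤ n) {ι : Type*} {L : Filter ι}
    {y : ι → Fin n → ℝ} {z : Fin n → ℝ} (hz : Monotone z)
    (hy : ∀ᶠ t in L, y t ∈ orderedTuples n)
    (h : ∀ k < n, Filter.Tendsto (fun t => revEsymm n k (y t)) L (𝓝 (revEsymm n k z))) :
    Filter.Tendsto y L (𝓝 z) := by
  refine (isCompact_esymmBox hn (fun k => revEsymm n k z - 1)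
    (fun k => revEsymm n k z + 1)).tendsto_nhds_of_unique_mapClusterPt ?_ ?_
  · have h' : ∀ᶠ t in L, ∀ k ∈ Finset.range n,
        revEsymm n k (y t) ∈ Icc (revEsymm n k z - 1) (revEsymm n k z + 1) := by
      rw [Finset.eventually_all]
      intro k hk
      exact (h k (Finset.mem_range.1 hk)) (Icc_mem_nhds (by linarith) (by linarith))
    filter_upwards [hy, h'] with t ht ht'
    exact ⟨fun i => (ht.1 i).le, ht.2, fun k hk => ht' k (Finset.mem_range.2 hk)⟩
  · rintro x ⟨-, hx, -⟩ hcl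
    -- A cluster point has the limiting coefficients, and a sorted tuple is determined by its
    -- polynomial.
    refine eq_of_shiftProd_eq hx hz (shiftProd_eq_of_revEsymm_eq fun k hk => ?_)
    have hc : MapClusterPt (revEsymm n k x) L (fun t => revEsymm n k (y t)) :=
      hcl.continuousAt_comp (continuous_revEsymm n k).continuousAt
    exact eq_of_nhds_neBot (hc.clusterPt.mono (h k hk) : ClusterPt _ (𝓝 (revEsymm n k z)))

/-! ### Perturbed polynomials with distinct real roots. -/

theorem degree_sum_C_mul_X_pow_lt {n : ℕ} {S : Finset ℕ} (hS : ∀ k ∈ S, k < n) (c : ℕ → ℝ) :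
    (∑ k ∈ S, C (c k) * X ^ k).degree < (n : WithBot ℕ) := by
  refine (degree_sum_le _ _).trans_lt ((Finset.sup_lt_iff (WithBot.bot_lt_coe n)).2 fun k hk => ?_)
  exact (degree_C_mul_X_pow_le k (c k)).trans_lt (Nat.cast_lt.2 (hS k hk))

theorem degree_shiftProd_sub_lt {n : ℕ} (y z : Fin n → ℝ) :
    (shiftProd y - shiftProd z).degree < (n : WithBot ℕ) := by
  have h : (shiftProd y).degree = n := by
    rw [degree_eq_natDegree (monic_shiftProd y).ne_zero, natDegree_shiftProd]
  have h' : (shiftProd z).degree = n := by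
    rw [degree_eq_natDegree (monic_shiftProd z).ne_zero, natDegree_shiftProd]
  rw [← h]
  exact degree_sub_lt_left (h.trans h'.symm) (monic_shiftProd y).ne_zero
    (by rw [(monic_shiftProd y).leadingCoeff, (monic_shiftProd z).leadingCoeff])

/-- If a perturbation with nonnegative coefficients has `n` distinct real roots, then they are
the negatives of an increasing positive tuple. -/
theorem exists_strictMono_shiftProd_eq {n : ℕ} {S : Finset ℕ} (hS : ∀ k ∈ S, k < n)
    {a : Fin n → ℝ} (ha : a ∈ orderedTuples n) {c : ℕ → ℝ} (hc : ∀ k ∈ S, 0 ≤ c k)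
    {x : Fin n → ℝ} (hx : Function.Injective x) (hr : ∀ i, (perturbedPoly a S c).IsRoot (x i)) :
    ∃ y ∈ orderedTuples n, StrictMono y ∧ shiftProd y = perturbedPoly a S c := by
  have hneg : ∀ i, x i < 0 := by
    intro i
    by_contra! h
    have h0 := hr i
    rw [IsRoot.def, perturbedPoly_eq, eval_add, eval_shiftProd, eval_finsetSum] at h0
    have h1 : 0 < ∏ j, (x i + a j) := Finset.prod_pos fun j _ => by linarith [ha.1 j]
    have h2 : 0 ≤ ∑ k ∈ S, eval (x i) (C (c k) * X ^ k) := Finset.sum_nonneg fun k hk => by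
      simpa using mul_nonneg (hc k hk) (pow_nonneg h k)
    linarith
  set z : Fin n → ℝ := fun i => -x i with hz
  set y := z ∘ Tuple.sort z with hy
  have hym : Monotone y := Tuple.monotone_sort z
  have hzi : Function.Injective z := fun i j h => hx (neg_injective h)
  have hyi : Function.Injective y := hzi.comp (Tuple.sort z).injective
  refine ⟨y, ⟨fun i => neg_pos.2 (hneg _), hym⟩, hym.strictMono_of_injective hyi, ?_⟩
  -- Both sides are monic of degree `n`, so agreement at the `n` distinct roots suffices.
  refine Polynomial.eq_of_degree_sub_lt_of_eval_index_eq Finset.univ hx.injOn ?_ ?_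
  · have : shiftProd y - perturbedPoly a S c =
        (shiftProd y - shiftProd a) - ∑ k ∈ S, C (c k) * X ^ k := by
      rw [perturbedPoly_eq]; ring
    rw [this, Finset.card_univ, Fintype.card_fin]
    exact (degree_sub_le _ _).trans_lt
      (max_lt (degree_shiftProd_sub_lt y a) (degree_sum_C_mul_X_pow_lt hS c))
  · intro i _
    rw [(hr i).eq_zero, eval_shiftProd]
    refine Finset.prod_eq_zero (Finset.mem_univ ((Tuple.sort z).symm i)) ?_
    simp [hy, hz]

/-! ### Differentiation along a moving polynomial. -/

section Derivative

variable {n : ℕ} {S : Finset ℕ} {y : ℝ → Fin n → ℝ} {c : ℕ → ℝ → ℝ} {c' : ℕ → ℝ} {s : Set ℝ}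
  {t₀ : ℝ}

/-- Derivative of a simple root along a family of polynomials. -/
theorem hasDerivWithinAt_root (hinj : Function.Injective (y t₀))
    (hcont : ContinuousWithinAt y s t₀)
    (hP : ∀ t ∈ s, shiftProd (y t) = shiftProd (y t₀) + ∑ k ∈ S, C (c k t - c k t₀) * X ^ k)
    (hc : ∀ k ∈ S, HasDerivWithinAt (c k) (c' k) s t₀) (i : Fin n) :
    HasDerivWithinAt (fun t => y t i)
      ((∑ k ∈ S, c' k * (-y t₀ i) ^ k) / ∏ j ∈ Finset.univ.erase i, (y t₀ j - y t₀ i)) s t₀ := by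
  rw [hasDerivWithinAt_iff_tendsto_slope]
  have hle : 𝓝[s \ {t₀}] t₀ ≤ 𝓝[s] t₀ := nhdsWithin_mono _ sdiff_subset
  have hyi : Filter.Tendsto (fun t => y t i) (𝓝[s \ {t₀}] t₀) (𝓝 (y t₀ i)) :=
    ((continuous_apply i).continuousAt.tendsto.comp hcont).mono_left hle
  have hQ : Filter.Tendsto (fun t => ∏ j ∈ Finset.univ.erase i, (y t₀ j - y t i))
      (𝓝[s \ {t₀}] t₀) (𝓝 (∏ j ∈ Finset.univ.erase i, (y t₀ j - y t₀ i))) :=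
    tendsto_finsetProd _ fun j _ => tendsto_const_nhds.sub hyi
  have hQ0 : ∏ j ∈ Finset.univ.erase i, (y t₀ j - y t₀ i) ≠ 0 :=
    Finset.prod_ne_zero_iff.2 fun j hj =>
      sub_ne_zero.2 fun h => (Finset.mem_erase.1 hj).1 (hinj h)
  have hN : Filter.Tendsto (fun t => ∑ k ∈ S, slope (c k) t₀ t * (-y t i) ^ k)
      (𝓝[s \ {t₀}] t₀) (𝓝 (∑ k ∈ S, c' k * (-y t₀ i) ^ k)) :=
    tendsto_finsetSum _ fun k hk =>
      ((hasDerivWithinAt_iff_tendsto_slope.1 (hc k hk))).mul (hyi.neg.pow k)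
  refine (hN.div hQ hQ0).congr' ?_
  filter_upwards [hQ.eventually_ne hQ0, self_mem_nhdsWithin] with t htQ ht
  have ht0 : t - t₀ ≠ 0 := sub_ne_zero.2 ht.2
  -- Evaluation at the moved root kills the left side; factoring `y t₀ i - y t i` out of the product
  -- on the right yields the difference quotient.
  have h := congrArg (eval (-y t i)) (hP t ht.1)
  rw [eval_add, eval_shiftProd, eval_shiftProd,
    Finset.prod_eq_zero (Finset.mem_univ i) (neg_add_cancel _),
    ← Finset.mul_prod_erase _ _ (Finset.mem_univ i), eval_finsetSum] at h
  simp only [eval_mul, eval_C, eval_pow, eval_X, neg_add_eq_sub] at h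
  rw [Pi.div_apply, div_eq_iff htQ]
  simp only [slope_def_field]
  have h2 : ∑ k ∈ S, (c k t - c k t₀) / (t - t₀) * (-y t i) ^ k =
      (∑ k ∈ S, (c k t - c k t₀) * (-y t i) ^ k) / (t - t₀) := by
    rw [Finset.sum_div]
    exact Finset.sum_congr rfl fun k _ => by ring
  rw [h2, div_mul_eq_mul_div]
  congr 1
  linarith

/-- Chain rule, with the double sum regrouped by `k` so that each inner sum is, up to sign, a
divided difference of `x^k f'`. -/
theorem hasDerivWithinAt_sum_comp_root (hinj : Function.Injective (y t₀))
    (hcont : ContinuousWithinAt y s t₀)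
    (hP : ∀ t ∈ s, shiftProd (y t) = shiftProd (y t₀) + ∑ k ∈ S, C (c k t - c k t₀) * X ^ k)
    (hc : ∀ k ∈ S, HasDerivWithinAt (c k) (c' k) s t₀)
    {f : ℝ → ℝ} (hf : ∀ i, DifferentiableAt ℝ f (y t₀ i)) :
    HasDerivWithinAt (fun t => ∑ i, f (y t i))
      (∑ k ∈ S, c' k * ∑ i, deriv f (y t₀ i) * (-y t₀ i) ^ k /
        ∏ j ∈ Finset.univ.erase i, (y t₀ j - y t₀ i)) s t₀ := by
  have h := HasDerivWithinAt.fun_sum (u := Finset.univ) fun i _ =>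
    (hf i).hasDerivAt.comp_hasDerivWithinAt t₀ (hasDerivWithinAt_root hinj hcont hP hc i)
  refine h.congr_deriv ?_
  simp only [Finset.mul_sum, Finset.sum_div]
  rw [Finset.sum_comm]
  exact Finset.sum_congr rfl fun i _ => Finset.sum_congr rfl fun k _ => by ring

end Derivative

/-- The weighted sum occurring in the derivative of `∑ f (y i)` is a value of the `(n-1)`-st
derivative of `t ^ k * f' t`. -/
theorem exists_iteratedDeriv_eq_weighted_sum {U : Set ℝ} (hU : IsOpen U) (hUc : U.OrdConnected)
    {n : ℕ} (hn : 1 ≤ n) {f : ℝ → ℝ} (hf : ContDiffOn ℝ n f U) (k : ℕ)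
    {y : Fin n → ℝ} (hy : StrictMono y) (hyU : ∀ i, y i ∈ U) :
    ∃ ξ ∈ U, ((n - 1).factorial : ℝ) * ∑ i, deriv f (y i) * (-y i) ^ k /
        ∏ j ∈ Finset.univ.erase i, (y j - y i) =
      -((-1 : ℝ) ^ (n + k) * iteratedDeriv (n - 1) (fun t => t ^ k * deriv f t) ξ) := by
  obtain ⟨m, rfl⟩ := Nat.exists_eq_add_of_le' hn
  have hg : ContDiffOn ℝ m (fun t => t ^ k * deriv f t) U :=
    (contDiff_id.pow k).contDiffOn.mul (hf.deriv_of_isOpen hU (by norm_cast))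
  obtain ⟨ξ, hξ, h⟩ := exists_iteratedDeriv_eq_dividedDifference hU hUc m _ y hy hg hyU
  refine ⟨ξ, hξ, ?_⟩
  rw [Nat.add_sub_cancel, h, mul_left_comm, ← mul_neg]
  congr 1
  rw [Finset.mul_sum, ← Finset.sum_neg_distrib]
  refine Finset.sum_congr rfl fun i _ => ?_
  have hprod : ∏ j ∈ Finset.univ.erase i, (y j - y i) =
      (-1) ^ m * ∏ j ∈ Finset.univ.erase i, (y i - y j) := by
    have : ∀ j, y j - y i = -1 * (y i - y j) := fun j => by ring
    simp_rw [this]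
    rw [Finset.prod_mul_distrib, Finset.prod_const, Finset.card_erase_of_mem (Finset.mem_univ i)]
    simp
  rw [hprod, neg_pow (y i) k]
  have h1 : ((-1 : ℝ) ^ m) * (-1) ^ m = 1 := by rw [← mul_pow]; simp
  have h2 : ((-1 : ℝ) ^ m)⁻¹ = (-1) ^ m := inv_eq_of_mul_eq_one_left h1
  rw [div_eq_mul_inv, mul_inv, h2]
  ring

theorem revEsymm_eq_add_of_shiftProd_eq {n : ℕ} {S : Finset ℕ} {y z : Fin n → ℝ} {c : ℕ → ℝ}
    (h : shiftProd y = shiftProd z + ∑ k ∈ S, C (c k) * X ^ k) {k : ℕ} (hk : k ≤ n) :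
    revEsymm n k y = revEsymm n k z + if k ∈ S then c k else 0 := by
  have := congrArg (fun p => p.coeff k) h
  simpa [coeff_shiftProd _ hk, finsetSum_coeff, coeff_C_mul, coeff_X_pow] using this

/-- Distinct entries are not required, so this also covers the start of a curve at a tuple with
repeated entries, where the derivative formula is unavailable. -/
theorem continuousWithinAt_of_shiftProd_eq {n : ℕ} (hn : 1 ≤ n) {S : Finset ℕ}
    {y : ℝ → Fin n → ℝ} {c : ℕ → ℝ → ℝ} {s : Set ℝ} {t₀ : ℝ} (ht₀ : t₀ ∈ s)
    (hy : ∀ t ∈ s, y t ∈ orderedTuples n)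
    (hP : ∀ t ∈ s, shiftProd (y t) = shiftProd (y t₀) + ∑ k ∈ S, C (c k t - c k t₀) * X ^ k)
    (hc : ∀ k ∈ S, ContinuousWithinAt (c k) s t₀) : ContinuousWithinAt y s t₀ := by
  refine tendsto_of_tendsto_revEsymm hn (hy t₀ ht₀).2 ?_ fun k hk => ?_
  · filter_upwards [self_mem_nhdsWithin] with t ht using hy t ht
  · have h : Filter.Tendsto
        (fun t => revEsymm n k (y t₀) + if k ∈ S then c k t - c k t₀ else 0) (𝓝[s] t₀)
        (𝓝 (revEsymm n k (y t₀))) := by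
      by_cases hkS : k ∈ S
      · have := ((hc k hkS).sub_const (c k t₀)).const_add (revEsymm n k (y t₀))
        simpa [hkS] using this
      · simpa [hkS] using tendsto_const_nhds
    refine h.congr' ?_
    filter_upwards [self_mem_nhdsWithin] with t ht
    exact (revEsymm_eq_add_of_shiftProd_eq (c := fun k => c k t - c k t₀) (hP t ht) hk.le).symm

/-! ### Necessity of the derivative condition. -/

/-- Polynomials with distinct real roots keep them under small perturbations. -/
theorem eventually_exists_injective_isRoot {n : ℕ} {a : Fin n → ℝ} (ha : Function.Injective a)
    (q : ℝ[X]) : ∀ᶠ t in 𝓝 (0 : ℝ), ∃ x : Fin n → ℝ, Function.Injective x ∧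
      ∀ i, (shiftProd a + C t * q).IsRoot (x i) := by
  -- With `η` below half of every gap, the closed intervals of radius `η` about the `-a i` are
  -- disjoint, and the polynomial changes sign across each.
  obtain ⟨η, hη, hη0⟩ : ∃ η : ℝ, (∀ i j, i ≠ j → 2 * η < |a i - a j|) ∧ 0 < η := by
    have h : ∀ᶠ η in 𝓝[>] (0 : ℝ), ∀ i j, i ≠ j → 2 * η < |a i - a j| := by
      refine Filter.eventually_all.2 fun i => Filter.eventually_all.2 fun j => ?_
      refine Filter.eventually_imp_distrib_left.2 fun hij => ?_
      have hc : Filter.Tendsto (fun η : ℝ => 2 * η) (𝓝[>] 0) (𝓝 (2 * 0)) :=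
        (continuous_const_mul 2).continuousAt.tendsto.mono_left nhdsWithin_le_nhds
      exact hc.eventually_lt_const (by simpa [sub_eq_zero] using ha.ne hij)
    exact (h.and self_mem_nhdsWithin).exists
  have hsign : ∀ i, (shiftProd a).eval (-a i - η) * (shiftProd a).eval (-a i + η) < 0 := by
    intro i
    rw [eval_shiftProd, eval_shiftProd, ← Finset.prod_mul_distrib,
      ← Finset.mul_prod_erase _ _ (Finset.mem_univ i)]
    refine mul_neg_of_neg_of_pos (by nlinarith) (Finset.prod_pos fun j hj => ?_)
    have h := hη j i (Finset.mem_erase.1 hj).1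
    rcases abs_cases (a j - a i) with ⟨h1, -⟩ | ⟨h1, -⟩ <;> rw [h1] at h <;> nlinarith
  have hev : ∀ᶠ t in 𝓝 (0 : ℝ), ∀ i, (shiftProd a + C t * q).eval (-a i - η) *
      (shiftProd a + C t * q).eval (-a i + η) < 0 := by
    refine Filter.eventually_all.2 fun i => ?_
    have hc : Continuous fun t : ℝ => (shiftProd a + C t * q).eval (-a i - η) *
      (shiftProd a + C t * q).eval (-a i + η) := by
      simp only [eval_add, eval_mul, eval_C]
      fun_prop
    exact hc.continuousAt.eventually_lt_const (by simpa using hsign i)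
  filter_upwards [hev] with t ht
  have hroot : ∀ i, ∃ x ∈ uIcc (-a i - η) (-a i + η), (shiftProd a + C t * q).eval x = 0 := by
    intro i
    refine intermediate_value_uIcc (shiftProd a + C t * q).continuous.continuousOn ?_
    rw [mem_uIcc]
    rcases mul_neg_iff.1 (ht i) with h | h
    · exact Or.inr ⟨h.2.le, h.1.le⟩
    · exact Or.inl ⟨h.1.le, h.2.le⟩
  choose x hx hx0 using hroot
  refine ⟨x, fun i j hij => ?_, hx0⟩
  by_contra hne
  have hi := hx i
  have hj := hx j
  rw [uIcc_of_le (by linarith)] at hi hj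
  rw [← hij] at hj
  have := hη i j hne
  rcases abs_cases (a i - a j) with ⟨h1, -⟩ | ⟨h1, -⟩ <;> linarith [hi.1, hi.2, hj.1, hj.2]

theorem continuousOn_iteratedDeriv_of_isOpen {U : Set ℝ} (hU : IsOpen U) {m : ℕ} {g : ℝ → ℝ}
    (hg : ContDiffOn ℝ m g U) : ContinuousOn (iteratedDeriv m g) U :=
  (hg.continuousOn_iteratedDerivWithin le_rfl hU.uniqueDiffOn).congr
    fun _ hx => (iteratedDerivWithin_of_isOpen hU hx).symm

/-- A one-parameter monotonicity property forces the sign of the derivative condition. -/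
theorem iteratedDeriv_nonpos_of_sum_le {n : ℕ} (hn : 2 ≤ n) {f : ℝ → ℝ}
    (hf : ContDiffOn ℝ n f (Ioi 0)) {k : ℕ} (hk : k < n)
    (h : ∀ a ∈ orderedTuples n, ∀ b ∈ orderedTuples n, revEsymm n k a ≤ revEsymm n k b →
      (∀ l < n, l ≠ k → revEsymm n l a = revEsymm n l b) → ∑ i, f (a i) ≤ ∑ i, f (b i))
    {x₀ : ℝ} (hx₀ : 0 < x₀) :
    (-1 : ℝ) ^ (n + k) * iteratedDeriv (n - 1) (fun t => t ^ k * deriv f t) x₀ ≤ 0 := by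
  by_contra! hpos
  have hg : ContDiffOn ℝ (n - 1 : ℕ) (fun t => t ^ k * deriv f t) (Ioi 0) :=
    (contDiff_id.pow k).contDiffOn.mul
      (hf.deriv_of_isOpen isOpen_Ioi (by norm_cast; omega))
  have hcont : ContinuousAt (fun x => (-1 : ℝ) ^ (n + k) *
      iteratedDeriv (n - 1) (fun t => t ^ k * deriv f t) x) x₀ :=
    ((continuousOn_iteratedDeriv_of_isOpen isOpen_Ioi hg).continuousAt
      (Ioi_mem_nhds hx₀)).const_mul _
  obtain ⟨η, hη, hηU⟩ := Metric.eventually_nhds_iff_ball.1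
    ((hcont.eventually_const_lt hpos).and (Ioi_mem_nhds hx₀))
  rw [Real.ball_eq_Ioo] at hηU
  have hn0 : (0 : ℝ) < n := by exact_mod_cast (by omega : 0 < n)
  -- Distinct nodes; `i / n < 1` keeps them within `η` of `x₀`, where the sign violation persists.
  set a : Fin n → ℝ := fun i => x₀ + η * (i / n) with ha
  have haU : ∀ i, a i ∈ Ioo (x₀ - η) (x₀ + η) := by
    intro i
    have h0 : (0 : ℝ) ≤ (i : ℝ) / n := by positivity
    have h1 : (i : ℝ) / n < 1 := by
      rw [div_lt_one hn0]
      exact_mod_cast i.2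
    constructor <;> simp only [ha] <;> nlinarith
  have hamono : StrictMono a := by
    intro i j hij
    simp only [ha]
    have : (i : ℝ) < j := by exact_mod_cast hij
    gcongr
  have haΔ : a ∈ orderedTuples n := ⟨fun i => (hηU _ (haU i)).2, hamono.monotone⟩
  obtain ⟨δ, hδ, hroots⟩ := Metric.eventually_nhds_iff_ball.1
    (eventually_exists_injective_isRoot hamono.injective (X ^ k))
  rw [Real.ball_eq_Ioo] at hroots
  -- Raise only the coefficient of `X ^ k`, by `t`; outside `[0, δ)` any value will do.
  have hex : ∀ t, ∃ y : Fin n → ℝ, t ∈ Ico 0 δ →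
      y ∈ orderedTuples n ∧ shiftProd y = shiftProd a + ∑ l ∈ {k}, C t * X ^ l := by
    intro t
    by_cases ht : t ∈ Ico 0 δ
    · obtain ⟨x, hx, hxr⟩ := hroots t ⟨by linarith [ht.1], by linarith [ht.2]⟩
      obtain ⟨y, hy, -, hyP⟩ := exists_strictMono_shiftProd_eq (S := {k}) (by simpa using hk) haΔ
        (c := fun _ => t) (fun _ _ => ht.1) hx (by simpa [perturbedPoly_eq] using hxr)
      exact ⟨y, fun _ => ⟨hy, hyP⟩⟩
    · exact ⟨a, fun h => absurd h ht⟩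
  choose y hy using hex
  have h0 : (0 : ℝ) ∈ Ico 0 δ := ⟨le_rfl, hδ⟩
  have hy0 : y 0 = a :=
    eq_of_shiftProd_eq (hy 0 h0).1.2 hamono.monotone (by rw [(hy 0 h0).2]; simp)
  have hP : ∀ t ∈ Ico 0 δ, shiftProd (y t) = shiftProd (y 0) +
      ∑ l ∈ {k}, C ((fun _ t => t : ℕ → ℝ → ℝ) l t - (fun _ t => t : ℕ → ℝ → ℝ) l 0) * X ^ l := by
    intro t ht
    rw [hy0, (hy t ht).2]
    simp
  have hycont : ContinuousWithinAt y (Ico 0 δ) 0 :=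
    continuousWithinAt_of_shiftProd_eq (by omega) h0 (fun t ht => (hy t ht).1) hP
      fun _ _ => continuousWithinAt_id
  have hder := hasDerivWithinAt_sum_comp_root (c' := fun _ => 1) (f := f)
    (by rw [hy0]; exact hamono.injective) hycont hP (fun _ _ => hasDerivWithinAt_id _ _)
    (fun i => (hf.differentiableOn (by norm_cast; omega)).differentiableAt
      (Ioi_mem_nhds ((hy 0 h0).1.1 i)))
  obtain ⟨ξ, hξ, hξe⟩ := exists_iteratedDeriv_eq_weighted_sum isOpen_Ioo ordConnected_Ioo
    (by omega : 1 ≤ n) (hf.mono fun x hx => (hηU x hx).2) k hamono haU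
  rw [hy0, Finset.sum_singleton, one_mul] at hder
  have hnonneg : 0 ≤ ∑ i, deriv f (a i) * (-a i) ^ k /
      ∏ j ∈ Finset.univ.erase i, (a j - a i) := by
    have hsl := hasDerivWithinAt_iff_tendsto_slope.1 hder
    rw [Ico_sdiff_left] at hsl
    have : (𝓝[Ioo 0 δ] (0 : ℝ)).NeBot := left_nhdsWithin_Ioo_neBot hδ
    -- The one-sided derivative at `0` is a limit of quotients that `h` makes nonnegative; the mean
    -- value form makes the same derivative negative.
    refine ge_of_tendsto hsl ?_
    filter_upwards [self_mem_nhdsWithin] with t ht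
    have htI : t ∈ Ico 0 δ := ⟨ht.1.le, ht.2⟩
    have hE : ∀ l ≤ n, revEsymm n l (y t) = revEsymm n l a + if l ∈ ({k} : Finset ℕ) then t else 0 :=
      fun l hl => revEsymm_eq_add_of_shiftProd_eq (c := fun _ => t) (hy t htI).2 hl
    rw [slope_def_field, hy0]
    refine div_nonneg (sub_nonneg.2 (h a haΔ (y t) (hy t htI).1 ?_ fun l hl hlk => ?_))
      (by linarith [ht.1])
    · rw [hE k hk.le]
      simpa using ht.1.le
    · rw [hE l hl.le]
      simp [hlk]
  have hfac : (0 : ℝ) < (n - 1).factorial := by positivity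
  have := (hηU ξ hξ).1
  nlinarith

/-! ### Sufficiency, from the conjecture. -/

/-- Along the curve provided by the conjecture the sum `∑ f (y i)` does not decrease. -/
theorem exists_sum_le_of_mainConjecture {n : ℕ} (hn : 2 ≤ n) {S : Finset ℕ} (hS : ∀ k ∈ S, k < n)
    (hconj : MainConjecture n S) {f : ℝ → ℝ} (hf : ContDiffOn ℝ n f (Ioi 0))
    (hder : ∀ x : ℝ, 0 < x → ∀ k ∈ S,
      (-1 : ℝ) ^ (n + k) * iteratedDeriv (n - 1) (fun t => t ^ k * deriv f t) x ≤ 0)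
    {a b : Fin n → ℝ} (ha : a ∈ orderedTuples n)
    (hlt : ∀ k ∈ S, revEsymm n k a < revEsymm n k b)
    (heq : ∀ k < n, k ∉ S → revEsymm n k a = revEsymm n k b) :
    ∃ d ∈ orderedTuples n, ∑ i, f (a i) ≤ ∑ i, f (d i) ∧
      (∀ k < n, revEsymm n k a ≤ revEsymm n k d ∧ revEsymm n k d ≤ revEsymm n k b) ∧
      ∑ k ∈ Finset.range n, revEsymm n k a < ∑ k ∈ Finset.range n, revEsymm n k d := by
  -- The gaps `E_k(b) - E_k(a)` serve as the `A_k`: the perturbed polynomial is that of `b`, hence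
  -- real-rooted.
  have hAb : perturbedPoly a S (fun k => revEsymm n k b - revEsymm n k a) = shiftProd b := by
    rw [perturbedPoly_eq]
    ext k
    rcases lt_or_ge k n with hk | hk
    · simp only [coeff_add, coeff_shiftProd _ hk.le, finsetSum_coeff, coeff_C_mul, coeff_X_pow]
      by_cases hkS : k ∈ S
      · simp [hkS]
      · simp [hkS, heq k hk hkS]
    · have h1 := coeff_eq_zero_of_degree_lt
        ((degree_shiftProd_sub_lt b a).trans_le (Nat.cast_le.2 hk))
      have h2 := coeff_eq_zero_of_degree_lt
        ((degree_sum_C_mul_X_pow_lt hS fun k => revEsymm n k b - revEsymm n k a).trans_le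
          (Nat.cast_le.2 hk))
      rw [coeff_sub] at h1
      rw [coeff_add, h2]
      linarith
  obtain ⟨ε, hε, B, hB, hBs, hBr⟩ := hconj a ha
    ⟨fun k => revEsymm n k b - revEsymm n k a, fun k hk => sub_pos.2 (hlt k hk), by
      intro z hz
      rw [hAb, shiftProd, map_prod, Finset.prod_eq_zero_iff] at hz
      obtain ⟨i, -, hi⟩ := hz
      have := congrArg Complex.im hi
      simpa using this⟩
  have hBnn : ∀ k ∈ S, ∀ t ∈ Icc 0 ε, 0 ≤ B k t := fun k hk t ht =>
    (hB k hk).2.2.2 ▸ (hB k hk).2.2.1 ⟨le_rfl, hε.le⟩ ht ht.1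
  have hBlt : ∀ᶠ t in 𝓝[>] (0 : ℝ), ∀ k ∈ S, B k t < revEsymm n k b - revEsymm n k a := by
    rw [Finset.eventually_all]
    intro k hk
    have hc : Filter.Tendsto (B k) (𝓝[>] 0) (𝓝 0) := by
      have := (hB k hk).1 0 ⟨le_rfl, hε.le⟩
      rw [ContinuousWithinAt, (hB k hk).2.2.2] at this
      rw [← nhdsWithin_Ioc_eq_nhdsGT hε]
      exact this.mono_left (nhdsWithin_mono _ Ioc_subset_Icc_self)
    exact hc.eventually_lt_const (sub_pos.2 (hlt k hk))
  -- Up to and including `δ`, the roots are distinct and no coefficient passes that of `b`; the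
  -- tuple `d` will be `y δ`.
  obtain ⟨δ, hδ0 : 0 < δ, hu'⟩ := mem_nhdsGT_iff_exists_Ioc_subset.1
    (Filter.inter_mem (hBr.and hBlt) (Ioc_mem_nhdsGT hε))
  have hδε : δ ≤ ε := (hu' ⟨hδ0, le_rfl⟩).2.2
  have hIcc : Icc 0 δ ⊆ Icc 0 ε := Icc_subset_Icc_right hδε
  -- Strictness is asked only for `t > 0`, since `a` may have repeated entries.
  have hex : ∀ t, ∃ y : Fin n → ℝ, t ∈ Icc 0 δ → y ∈ orderedTuples n ∧ (0 < t → StrictMono y) ∧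
      shiftProd y = shiftProd a + ∑ k ∈ S, C (B k t) * X ^ k := by
    intro t
    by_cases ht : t ∈ Icc 0 δ
    · rcases ht.1.eq_or_lt with h0 | h0
      · refine ⟨a, fun _ => ⟨ha, fun h => absurd h0 h.ne, ?_⟩⟩
        rw [← h0, Finset.sum_eq_zero, add_zero]
        intro k hk
        rw [(hB k hk).2.2.2, C_0, zero_mul]
      · obtain ⟨x, hx, hxr⟩ := (hu' ⟨h0, ht.2⟩).1.1
        obtain ⟨y, hy, hys, hyP⟩ := exists_strictMono_shiftProd_eq hS ha
          (fun k hk => hBnn k hk t (hIcc ht)) hx hxr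
        exact ⟨y, fun _ => ⟨hy, fun _ => hys, hyP⟩⟩
    · exact ⟨a, fun h => absurd h ht⟩
  choose y hy using hex
  have hP : ∀ t₀ ∈ Icc 0 δ, ∀ t ∈ Icc 0 δ,
      shiftProd (y t) = shiftProd (y t₀) + ∑ k ∈ S, C (B k t - B k t₀) * X ^ k := by
    intro t₀ ht₀ t ht
    rw [(hy t ht).2.2, (hy t₀ ht₀).2.2]
    simp only [C_sub, sub_mul, Finset.sum_sub_distrib]
    ring
  have hycont : ∀ t₀ ∈ Icc 0 δ, ContinuousWithinAt y (Icc 0 δ) t₀ := fun t₀ ht₀ =>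
    continuousWithinAt_of_shiftProd_eq (by omega) ht₀ (fun t ht => (hy t ht).1) (hP t₀ ht₀)
      fun k hk => ((hB k hk).1 t₀ (hIcc ht₀)).mono hIcc
  have hIoo : Ioo 0 δ ⊆ Icc 0 δ := Ioo_subset_Icc_self
  have hmono : MonotoneOn (fun t => ∑ i, f (y t i)) (Icc 0 δ) := by
    refine monotoneOn_of_hasDerivWithinAt_nonneg (convex_Icc 0 δ)
      (f' := fun t => ∑ k ∈ S, derivWithin (B k) (Ioo 0 δ) t * ∑ i, deriv f (y t i) *
        (-y t i) ^ k / ∏ j ∈ Finset.univ.erase i, (y t j - y t i)) ?_ ?_ ?_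
    · intro t ht
      refine tendsto_finsetSum _ fun i _ => ?_
      exact (hf.continuousOn.continuousAt (Ioi_mem_nhds ((hy t ht).1.1 i))).tendsto.comp
        ((continuous_apply i).continuousAt.tendsto.comp (hycont t ht))
    · rw [interior_Icc]
      intro t ht
      refine hasDerivWithinAt_sum_comp_root ((hy t (hIoo ht)).2.1 ht.1).injective
        ((hycont t (hIoo ht)).mono hIoo) (fun t' ht' => hP t (hIoo ht) t' (hIoo ht'))
        (fun k hk => ?_) (fun i => (hf.differentiableOn (by norm_cast; omega)).differentiableAt
          (Ioi_mem_nhds ((hy t (hIoo ht)).1.1 i)))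
      exact (((hB k hk).2.1 t (Ioo_subset_Ioo_right hδε ht)).mono
        (Ioo_subset_Ioo_right hδε)).hasDerivWithinAt
    · rw [interior_Icc]
      intro t ht
      refine Finset.sum_nonneg fun k hk => mul_nonneg
        (((hB k hk).2.2.1.mono (hIoo.trans hIcc)).derivWithin_nonneg) ?_
      obtain ⟨ξ, hξ, h⟩ := exists_iteratedDeriv_eq_weighted_sum isOpen_Ioi ordConnected_Ioi
        (by omega : 1 ≤ n) hf k ((hy t (hIoo ht)).2.1 ht.1) (hy t (hIoo ht)).1.1
      have hfac : (0 : ℝ) < (n - 1).factorial := by positivity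
      refine nonneg_of_mul_nonneg_right ?_ hfac
      rw [h]
      exact neg_nonneg.2 (hder ξ hξ k hk)
  have h0 : (0 : ℝ) ∈ Icc 0 δ := ⟨le_rfl, hδ0.le⟩
  have h1 : δ ∈ Icc 0 δ := ⟨hδ0.le, le_rfl⟩
  have hy0 : y 0 = a := by
    refine eq_of_shiftProd_eq (hy 0 h0).1.2 ha.2 ?_
    rw [(hy 0 h0).2.2, Finset.sum_eq_zero, add_zero]
    intro k hk
    rw [(hB k hk).2.2.2, C_0, zero_mul]
  have hE : ∀ k < n, revEsymm n k (y δ) = revEsymm n k a + if k ∈ S then B k δ else 0 :=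
    fun k hk => revEsymm_eq_add_of_shiftProd_eq (c := fun k => B k δ) (hy δ h1).2.2 hk.le
  refine ⟨y δ, (hy δ h1).1, ?_, fun k hk => ?_, ?_⟩
  · have := hmono h0 h1 hδ0.le
    simpa [hy0] using this
  · rw [hE k hk]
    by_cases hkS : k ∈ S
    · have h2 := (hu' ⟨hδ0, le_rfl⟩).1.2 k hkS
      have h3 := hBnn k hkS δ (hIcc h1)
      simp only [hkS, if_true]
      constructor <;> linarith
    · simp [hkS, heq k hk hkS]
  · rw [Finset.sum_congr rfl fun k hk => hE k (Finset.mem_range.1 hk), Finset.sum_add_distrib,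
      ← Finset.sum_filter, Finset.filter_mem_eq_inter,
      Finset.inter_eq_right.2 fun k hk => Finset.mem_range.2 (hS k hk)]
    -- The individual `B k` need not grow strictly; only their sum does, which is why progress is
    -- measured by the sum of the `E_k`.
    have h2 := hBs (hIcc h0) (hIcc h1) hδ0
    have h3 : ∑ k ∈ S, B k 0 = 0 := Finset.sum_eq_zero fun k hk => (hB k hk).2.2.2
    simp only [h3] at h2
    linarith

/-- The conjecture propagates the monotonicity of `∑ f (y i)` along the coefficientwise order. -/
theorem sum_le_of_mainConjecture {n : ℕ} (hn : 2 ≤ n) {T : Finset ℕ}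
    (hT : T ⊆ Finset.Icc 1 (n - 1))
    (hconj : ∀ S : Finset ℕ, S.Nonempty → S ⊆ T → MainConjecture n S)
    {f : ℝ → ℝ} (hf : ContDiffOn ℝ n f (Ioi 0))
    (hder : ∀ x : ℝ, 0 < x → ∀ k ∈ T,
      (-1 : ℝ) ^ (n + k) * iteratedDeriv (n - 1) (fun t => t ^ k * deriv f t) x ≤ 0)
    {a b : Fin n → ℝ} (ha : a ∈ orderedTuples n) (hb : b ∈ orderedTuples n)
    (hle : ∀ k ∈ T, revEsymm n k a ≤ revEsymm n k b)
    (heq : ∀ k < n, k ∉ T → revEsymm n k a = revEsymm n k b) :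
    ∑ i, f (a i) ≤ ∑ i, f (b i) := by
  have hle' : ∀ k < n, revEsymm n k a ≤ revEsymm n k b := fun k hk =>
    if h : k ∈ T then hle k h else (heq k hk h).le
  set K := esymmBox n (fun k => revEsymm n k a) (fun k => revEsymm n k b)
  -- The lower bound on `E_0`, the product of the entries, keeps them away from zero, where `f` is
  -- uncontrolled.
  have hKpos : K ⊆ orderedTuples n := by
    rintro y ⟨hy, hym, hE⟩
    refine ⟨pos_of_revEsymm_zero_pos hy (lt_of_lt_of_le ?_ (hE 0 (by omega)).1), hym⟩
    dsimp only
    rw [revEsymm_zero]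
    exact Finset.prod_pos fun i _ => ha.1 i
  have hKc : IsCompact K := isCompact_esymmBox (by omega) _ _
  have hF : ContinuousOn (fun y : Fin n → ℝ => ∑ i, f (y i)) K :=
    continuousOn_finsetSum _ fun i _ => hf.continuousOn.comp (continuous_apply i).continuousOn
      fun y hy => (hKpos hy).1 i
  have hK'c : IsCompact (K ∩ (fun y : Fin n → ℝ => ∑ i, f (y i)) ⁻¹' Ici (∑ i, f (a i))) :=
    hKc.of_isClosed_subset (hF.preimage_isClosed_of_isClosed hKc.isClosed isClosed_Ici)
      inter_subset_left
  have haK : a ∈ K := ⟨fun i => (ha.1 i).le, ha.2, fun k hk => ⟨le_rfl, hle' k hk⟩⟩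
  obtain ⟨c, ⟨hcK, hcF⟩, hcmax⟩ := hK'c.exists_isMaxOn ⟨a, haK, le_refl (∑ i, f (a i))⟩
    (continuous_finsetSum (Finset.range n) fun k _ => continuous_revEsymm n k).continuousOn
  have hcF : ∑ i, f (a i) ≤ ∑ i, f (c i) := hcF
  have hcE := hcK.2.2
  have hcb : ∀ k < n, k ∉ T → revEsymm n k c = revEsymm n k b := fun k hk hkT =>
    le_antisymm (hcE k hk).2 ((heq k hk hkT).symm.le.trans (hcE k hk).1)
  have hTn : ∀ k ∈ T, k < n := fun k hk => by
    have := Finset.mem_Icc.1 (hT hk)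
    omega
  -- The coefficients that can still grow; `S` depends on the maximizer `c`, so the conjecture is
  -- needed for all nonempty subsets of `T`.
  set S := T.filter fun k => revEsymm n k c < revEsymm n k b with hS
  have hST : S ⊆ T := Finset.filter_subset _ _
  have hcS : ∀ k < n, k ∉ S → revEsymm n k c = revEsymm n k b := by
    intro k hk hkS
    by_cases hkT : k ∈ T
    · exact le_antisymm (hcE k hk).2
        (not_lt.1 fun h => hkS (Finset.mem_filter.2 ⟨hkT, h⟩))
    · exact hcb k hk hkT
  rcases S.eq_empty_or_nonempty with hSe | hSne
  · have : c = b := eq_of_shiftProd_eq hcK.2.1 hb.2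
      (shiftProd_eq_of_revEsymm_eq fun k hk => hcS k hk (by simp [hSe]))
    rwa [← this]
  · obtain ⟨d, hd, hdF, hdE, hdlt⟩ := exists_sum_le_of_mainConjecture hn
      (fun k hk => hTn k (hST hk)) (hconj S hSne hST) hf
      (fun x hx k hk => hder x hx k (hST hk)) (hKpos hcK)
      (fun k hk => (Finset.mem_filter.1 hk).2) hcS
    have hdK : d ∈ K := ⟨fun i => (hd.1 i).le, hd.2, fun k hk =>
      ⟨(hcE k hk).1.trans (hdE k hk).1, (hdE k hk).2⟩⟩
    have := hcmax ⟨hdK, hcF.trans hdF⟩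
    exact absurd hdlt (not_lt.2 this)

theorem corollary4 (n : ℕ) (hn : 2 ≤ n) (T : Finset ℕ) (hT : T ⊆ Finset.Icc 1 (n - 1))
    (hconj : ∀ S : Finset ℕ, S.Nonempty → S ⊆ T → MainConjecture n S)
    (f : ℝ → ℝ) (hf : ContDiffOn ℝ n f (Ioi 0)) :
    (∀ a ∈ orderedTuples n, ∀ b ∈ orderedTuples n,
      (∀ k ∈ T, revEsymm n k a ≤ revEsymm n k b) →
      (∀ k < n, k = 0 ∨ k ∉ T → revEsymm n k a = revEsymm n k b) →
      ∑ i, f (a i) ≤ ∑ i, f (b i)) ↔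
    (∀ x : ℝ, 0 < x → ∀ k ∈ T,
      (-1 : ℝ) ^ (n + k) * iteratedDeriv (n - 1) (fun t => t ^ k * deriv f t) x ≤ 0) := by
  constructor
  · intro h x hx k hk
    have hkI := Finset.mem_Icc.1 (hT hk)
    -- Pairs differing in the single coefficient `k` are admissible in condition 1, because `k ∈ T`
    -- and `k ≠ 0`.
    refine iteratedDeriv_nonpos_of_sum_le hn hf (by omega) (fun a ha b hb hle heq => ?_) hx
    refine h a ha b hb (fun l hl => ?_) fun l hl hl' => heq l hl ?_
    · by_cases hlk : l = k
      · rwa [hlk]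
      · have := Finset.mem_Icc.1 (hT hl)
        exact (heq l (by omega) hlk).le
    · rintro rfl
      rcases hl' with h0 | h0
      · omega
      · exact h0 hk
  · intro h a ha b hb hle heq
    exact sum_le_of_mainConjecture hn hT hconj hf h ha hb hle fun k hk hkT =>
      heq k hk (Or.inr hkT)
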